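/- Consider a radar link with pulse duration $T>0$, duty cycle $\delta>0$, bandwidth $B>0$, bandwidth fraction $\beta>0$, transmit power $P_{BS}>0$, target distance $d_r>0$, path loss exponent $\alpha_r\in\mathbb R$, intercept $C_r=\sigma_{RCS}\lambda^2/(4\pi)^3$ with radar cross section $\sigma_{RCS}>0$ and wavelength $\lambda>0$, time-delay variance $\sigma_\tau^2>0$, $\gamma^2=(2\pi)^2/12$ and noise power $\sigma^2=k_BT_{temp}\beta B$ with $k_B,T_{temp}>0$. Let $h_{r,d}$ and $h_{r,u}$ be the downlink and uplink fading coefficients, with independent power gains, and let $$\gamma_r^{echo}=\frac{P_{BS}\,C_r d_r^{-\alpha_r}\,|h_{r,d}|^2|h_{r,u}|^2\,\gamma^2\beta^2B^2\sigma_\tau^2}{\sigma^2}$$ be the SNR of the radar echo. The ergodic radar estimation information rate (REIR) is $R_{est}=\mathbb E\big[\frac{\delta}{2T}\log_2(1+2T\beta B\gamma_r^{echo})\big]$. Put $$\Xi_{r,1}=2T\beta B\cdot\frac{P_{BS}\,C_r\,\gamma^2\beta^2B^2\sigma_\tau^2}{\sigma^2},\qquad\text{so that } 2T\beta B\gamma_r^{echo}=\Xi_{r,1}d_r^{-\alpha_r}|h_{r,d}|^2|h_{r,u}|^2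 .$$ For $z>0$, let $G^{m,n}_{p,q}(z\,|\,a_1,\dots,a_p;b_1,\dots,b_q)$ be the Meijer G-function $$\frac1{2\pi i}\int_{c-i\infty}^{c+i\infty}\frac{\prod_{j=1}^m\Gamma(b_j+s)\prod_{i=1}^n\Gamma(1-a_i-s)}{\prod_{j=m+1}^q\Gamma(1-b_j-s)\prod_{i=n+1}^p\Gamma(a_i+s)}\,z^{-s}\,ds ,$$ where the line $\mathrm{Re}\,s=c$ separates the poles of the $\Gamma(b_j+s)$, $j\le m$, from those of the $\Gamma(1-a_i-s)$, $i\le n$. Assume Rayleigh fading on both hops, that is, Nakagami-$m$ fading with $m=1$: each of $|h_{r,d}|^2$ and $|h_{r,u}|^2$ has density $e^{-x}$ on $x>0$. Then the expectation, the integral and the Meijer G-values below exist (the integrals converge absolutely), and $$R_{est}=\frac{\delta}{2T\ln 2}\int_0^\infty\frac1{z+1}\Big(1-G^{2,1}_{1,3}\Big(\tfrac{d_r^{\alpha_r}}{\Xi_{r,1}}z\,\Big|\,1;1,1,0\Big)\Big)dz=\frac{\delta}{2T\ln 2}\,G^{3,1}_{1,3}\Big(\frac{d_r^{\alpha_r}}{\Xi_{r,1}}\,\Big|\,0;0,0,1\Big).$$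 -/

import Mathlib

open MeasureTheory ProbabilityTheory

noncomputable section

/-! ### The Meijer G-function -/

/-- The integrand of the Mellin-Barnes integral of `G^{m,n}_{p,q}(z | a; b)`, that is
`∏_{j ≤ m} Γ(b_j + s) ∏_{i ≤ n} Γ(1 - a_i - s) /
  (∏_{j > m} Γ(1 - b_j - s) ∏_{i > n} Γ(a_i + s)) * z^{-s}`
(the indices of `Fin` start at `0`, so the first `m` indices are those with `j < m`). -/
def meijerIntegrand {p q : ℕ} (m n : ℕ) (a : Fin p → ℂ) (b : Fin q → ℂ) (z s : ℂ) : ℂ :=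
  (∏ j : Fin q, if (j : ℕ) < m then Complex.Gamma (b j + s)
      else (Complex.Gamma (1 - b j - s))⁻¹) *
    (∏ i : Fin p, if (i : ℕ) < n then Complex.Gamma (1 - a i - s)
      else (Complex.Gamma (a i + s))⁻¹) *
    z ^ (-s)

/-- The line `Re s = c` separates the poles of the `Γ(b_j + s)`, `j ≤ m` (to its left), from the
poles of the `Γ(1 - a_i - s)`, `i ≤ n` (to its right). -/
def MeijerSeparates {p q : ℕ} (m n : ℕ) (a : Fin p → ℂ) (b : Fin q → ℂ) (c : ℝ) : Prop :=
  (∀ j : Fin q, (j : ℕ) < m → -(b j).re < c) ∧ ∀ i : Fin p, (i : ℕ) < n → c < 1 - (a i).re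

/-- `w` is the value of `G^{m,n}_{p,q}(z | a; b)`: there is a vertical line that separates the two
families of poles, and over each such line, run upwards, the integral
`(1 / (2 π i)) ∫ (meijerIntegrand m n a b z s) ds` converges absolutely and equals `w`
(on `s = c + i t` one has `ds = i dt`). -/
def HasMeijerG {p q : ℕ} (m n : ℕ) (a : Fin p → ℂ) (b : Fin q → ℂ) (z w : ℂ) : Prop :=
  (∃ c : ℝ, MeijerSeparates m n a b c) ∧
    ∀ c : ℝ, MeijerSeparates m n a b c →
      Integrable (fun t : ℝ => meijerIntegrand m n a b z (c + t * Complex.I)) ∧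
      (2 * (Real.pi : ℂ))⁻¹ * ∫ t : ℝ, meijerIntegrand m n a b z (c + t * Complex.I) = w

/-- The Mellin-Barnes integral of `G^{m,n}_{p,q}(z | a; b)` over vertical lines has a value. -/
def MeijerGConverges {p q : ℕ} (m n : ℕ) (a : Fin p → ℂ) (b : Fin q → ℂ) (z : ℂ) : Prop :=
  ∃ w : ℂ, HasMeijerG m n a b z w

open Classical in
/-- The Meijer G-function `G^{m,n}_{p,q}(z | a; b)`, with the value `0` where its Mellin-Barnes
integral over separating vertical lines has no value. -/
def meijerG {p q : ℕ} (m n : ℕ) (a : Fin p → ℂ) (b : Fin q → ℂ) (z : ℂ) : ℂ :=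
  if h : MeijerGConverges m n a b z then h.choose else 0

theorem HasMeijerG.meijerG_eq {p q m n : ℕ} {a : Fin p → ℂ} {b : Fin q → ℂ} {z w : ℂ}
    (h : HasMeijerG m n a b z w) : meijerG m n a b z = w := by
  have hc : MeijerGConverges m n a b z := ⟨w, h⟩
  obtain ⟨c, hsep⟩ := h.1
  rw [meijerG, dif_pos hc, ← (hc.choose_spec.2 c hsep).2, ← (h.2 c hsep).2]

/-! ### The radar link -/

/-- `h` is a Nakagami-`m` fading coefficient of mean power one: its power gain `|h|²` has the
density `m^m / Γ(m) * x^(m-1) * exp (-m x)` on `x > 0`. -/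
def IsNakagamiFading {Ω : Type*} [MeasurableSpace Ω] (P : Measure Ω) (m : ℝ) (h : Ω → ℂ) : Prop :=
  HasLaw (fun ω => ‖h ω‖ ^ 2) (gammaMeasure m m) P

/-- Rayleigh fading is Nakagami-`m` fading with `m = 1`. -/
def IsRayleighFading {Ω : Type*} [MeasurableSpace Ω] (P : Measure Ω) (h : Ω → ℂ) : Prop :=
  IsNakagamiFading P 1 h

/-- The physical parameters of the radar link. -/
structure RadarLink where
  /-- radar pulse duration `T` -/
  T : ℝ
  /-- radar duty cycle `δ` -/
  δ : ℝ
  /-- total bandwidth `B` -/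
  B : ℝ
  /-- fraction `β_semi` of the bandwidth used for integrated sensing and communication -/
  β : ℝ
  /-- transmit power `P_BS` of the base station -/
  P_BS : ℝ
  /-- distance `d_r` between base station and radar target -/
  d_r : ℝ
  /-- path loss exponent `α_r` of the radar echoes -/
  α_r : ℝ
  /-- radar cross section `σ_RCS` -/
  σ_RCS : ℝ
  /-- carrier wavelength -/
  wavelength : ℝ
  /-- standard deviation `σ_τ` of the time delay -/
  σ_τ : ℝ
  /-- Boltzmann constant -/
  k_B : ℝ
  /-- absolute temperature -/
  T_temp : ℝ
  T_pos : 0 < T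
  δ_pos : 0 < δ
  B_pos : 0 < B
  β_pos : 0 < β
  P_BS_pos : 0 < P_BS
  d_r_pos : 0 < d_r
  σ_RCS_pos : 0 < σ_RCS
  wavelength_pos : 0 < wavelength
  σ_τ_pos : 0 < σ_τ
  k_B_pos : 0 < k_B
  T_temp_pos : 0 < T_temp

namespace RadarLink

/-- `C_r = σ_RCS λ² / (4π)³`. -/
def C_r (S : RadarLink) : ℝ := S.σ_RCS * S.wavelength ^ 2 / (4 * Real.pi) ^ 3

/-- The path loss `C_r d_r^{-α_r}` of the radar echo. -/
def pathLoss (S : RadarLink) : ℝ := S.C_r * S.d_r ^ (-S.α_r)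

/-- `γ² = (2π)² / 12`, for a flat spectral shape. -/
def gammaSq : ℝ := (2 * Real.pi) ^ 2 / 12

/-- The noise power `σ² = k_B T_temp β_semi B`. -/
def noise (S : RadarLink) : ℝ := S.k_B * S.T_temp * S.β * S.B

/-- The SNR of the radar echo, for the downlink and uplink power gains `x = |h_{r,d}|²` and
`y = |h_{r,u}|²`. -/
def echoSNR (S : RadarLink) (x y : ℝ) : ℝ :=
  S.P_BS * S.pathLoss * x * y * gammaSq * S.β ^ 2 * S.B ^ 2 * S.σ_τ ^ 2 / S.noise

/-- The radar estimation information rate for the power gains `x`, `y`. -/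
def reir (S : RadarLink) (x y : ℝ) : ℝ :=
  S.δ / (2 * S.T) * Real.logb 2 (1 + 2 * S.T * S.β * S.B * S.echoSNR x y)

/-- The ergodic REIR: the expectation of the rate over the fading of both hops. -/
def ergodicREIR {Ω : Type*} [MeasurableSpace Ω] (S : RadarLink) (P : Measure Ω)
    (h_d h_u : Ω → ℂ) : ℝ :=
  ∫ ω, S.reir (‖h_d ω‖ ^ 2) (‖h_u ω‖ ^ 2) ∂P

/-- `Ξ_{r,1}`, the quantity with
`2 T β_semi B * echoSNR x y = Ξ_{r,1} * d_r^{-α_r} * x * y`. -/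
def Xi (S : RadarLink) : ℝ :=
  2 * S.T * S.β * S.B *
    (S.P_BS * S.C_r * gammaSq * S.β ^ 2 * S.B ^ 2 * S.σ_τ ^ 2 / S.noise)

/-- The integrand `(1 / (z + 1)) (1 - G^{2,1}_{1,3}(m² d_r^{α_r} z / Ξ_{r,1} | 1; m, m, 0) / Γ(m)²)`
in the integral form of the ergodic REIR under Nakagami-`m` fading. -/
def rateIntegrand (S : RadarLink) (m : ℝ) (z : ℝ) : ℂ :=
  1 / ((z : ℂ) + 1) *
    (1 - meijerG 2 1 ![1] ![(m : ℂ), (m : ℂ), 0]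
          ((m ^ 2 * S.d_r ^ S.α_r / S.Xi * z : ℝ) : ℂ) / ((Real.Gamma m : ℝ) : ℂ) ^ 2)

/-- The integral form of the ergodic REIR under Nakagami-`m` fading. -/
def rateIntegral (S : RadarLink) (m : ℝ) : ℂ :=
  ((S.δ / (2 * S.T * Real.log 2) : ℝ) : ℂ) * ∫ z in Set.Ioi (0 : ℝ), S.rateIntegrand m z

/-- The closed form `δ / (2 T ln 2) * G^{3,1}_{1,3}(d_r^{α_r} / Ξ_{r,1} | 0; 0, 0, 1)`. -/
def rayleighClosedForm (S : RadarLink) : ℂ :=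
  ((S.δ / (2 * S.T * Real.log 2) : ℝ) : ℂ) *
    meijerG 3 1 ![0] ![0, 0, 1] ((S.d_r ^ S.α_r / S.Xi : ℝ) : ℂ)

end RadarLink

end

/-! Write `W = X * Y` for the product of the two independent unit exponential gains and `r = d_r ^
α_r / Ξ`. The rate is a constant times `log (1 + W / r)`. Both the distribution function `P (W ≤ x)`
and the mean `E log (1 + W / x)` are averages of dilates `E f (x / W)`, with `f` the indicator of
`[1, ∞)` or `log (1 + 1 / x)`. The Mellin transform of such an average is `E (W ^ s) = Γ(1 + s) ^ 2`
times that of `f` (`hasMellin_gainLaw`), and `Γ(1 + s) = s * Γ(s)` turns the products into the two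
Meijer integrands. Mellin inversion (`hasMeijerG_of_mellin`) then identifies the two functions with
the G-values.

The integral form follows from `log (1 + W / r) = ∫ dz / (z + 1)` over `0 < z < W / r`: by Fubini,
its mean is the integral of `P (W > r * z) / (z + 1)`. -/

open Set Filter Topology

/-! ### Mellin transforms of averaged dilates -/

/-- Mellin transform of a weighted average of dilates of a function. -/
theorem hasMellin_integral_smul_comp_mul_left {α : Type*} [MeasurableSpace α] {μ : Measure α}
    [SFinite μ] {w : α → ℂ} {φ : α → ℝ} (hw : Measurable w) (hφ : Measurable φ)
    (hpos : ∀ᵐ a ∂μ, 0 < φ a) {f : ℝ → ℂ} (hfm : Measurable f) {s : ℂ}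
    (hf : MellinConvergent f s) (hint : Integrable (fun a => w a * (φ a : ℂ) ^ (-s)) μ) :
    HasMellin (fun x => ∫ a, w a * f (φ a * x) ∂μ) s
      ((∫ a, w a * (φ a : ℂ) ^ (-s) ∂μ) * mellin f s) := by
  have hmeas : AEStronglyMeasurable
      (fun p : α × ℝ => (p.2 : ℂ) ^ (s - 1) * (w p.1 * f (φ p.1 * p.2)))
      (μ.prod (volume.restrict (Ioi 0))) := by
    apply Measurable.aestronglyMeasurable
    fun_prop
  -- The substitution `x ↦ φ a * x` scales the absolute Mellin integral by `φ a ^ (-s.re)`, so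
  -- `hint` supplies the Tonelli condition on the product space.
  have hnorm : ∀ a, 0 < φ a → ∫ x in Ioi (0 : ℝ), ‖(x : ℂ) ^ (s - 1) * (w a * f (φ a * x))‖ =
      ‖w a * (φ a : ℂ) ^ (-s)‖ * ∫ x in Ioi (0 : ℝ), ‖(x : ℂ) ^ (s - 1) * f x‖ := by
    intro a ha
    have h := integral_comp_mul_left_Ioi (fun x : ℝ => ‖(x : ℂ) ^ (s - 1) * f x‖) 0 ha
    rw [mul_zero, smul_eq_mul] at h
    rw [norm_mul, mul_assoc, Complex.norm_cpow_eq_rpow_re_of_pos ha]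
    have e : (φ a) ^ (-s).re = (φ a) ^ (-(s - 1)).re * (φ a)⁻¹ := by
      rw [← Real.rpow_neg_one, ← Real.rpow_add ha]; simp; ring_nf
    rw [e, mul_assoc ((φ a) ^ (-(s - 1)).re), ← h, ← integral_const_mul, ← integral_const_mul]
    refine setIntegral_congr_fun measurableSet_Ioi fun x (hx : 0 < x) => ?_
    simp only [norm_mul]
    rw [Complex.norm_cpow_eq_rpow_re_of_pos hx, Complex.norm_cpow_eq_rpow_re_of_pos (mul_pos ha hx),
      Real.mul_rpow ha.le hx.le, Complex.neg_re, Real.rpow_neg ha.le]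
    have := (Real.rpow_pos_of_pos ha (s - 1).re).ne'
    field_simp
  have hprod : Integrable (fun p : α × ℝ => (p.2 : ℂ) ^ (s - 1) * (w p.1 * f (φ p.1 * p.2)))
      (μ.prod (volume.restrict (Ioi 0))) := by
    rw [integrable_prod_iff hmeas]
    constructor
    · filter_upwards [hpos] with a ha
      have := ((MellinConvergent.comp_mul_left (s := s) ha).2 hf).const_smul (w a)
      simpa only [MellinConvergent, smul_eq_mul] using! this
    · refine (hint.norm.mul_const (∫ x in Ioi (0 : ℝ), ‖(x : ℂ) ^ (s - 1) * f x‖)).congr ?_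
      filter_upwards [hpos] with a ha
      exact (hnorm a ha).symm
  constructor
  · have := hprod.integral_prod_right
    simpa only [MellinConvergent, smul_eq_mul, integral_const_mul] using! this
  · have := integral_integral_swap
      (f := fun a (x : ℝ) => (x : ℂ) ^ (s - 1) * (w a * f (φ a * x))) hprod
    simp only [integral_const_mul (μ := μ)] at this
    rw [← integral_mul_const, mellin]
    simp only [smul_eq_mul]
    rw [← this]
    refine integral_congr_ae ?_
    filter_upwards [hpos] with a ha
    rw [mul_assoc, ← smul_eq_mul ((φ a : ℂ) ^ (-s)), ← mellin_comp_mul_left f s ha, mellin,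
      ← integral_const_mul]
    congr 1 with x
    rw [smul_eq_mul]
    ring

/-! ### The exponential law and its moments -/

theorem gammaMeasure_one_one : gammaMeasure 1 1 =
    (volume.restrict (Ioi 0)).withDensity (fun x => ENNReal.ofReal (Real.exp (-x))) := by
  rw [← Measure.restrict_congr_set Ioi_ae_eq_Ici.symm, ← withDensity_indicator measurableSet_Ici, gammaMeasure]
  congr 1 with x
  by_cases hx : 0 ≤ x
  · simp [gammaPDF_of_nonneg hx, hx]
  · simp [gammaPDF_of_neg (not_le.1 hx), hx]

instance : IsProbabilityMeasure (gammaMeasure 1 1) :=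
  isProbabilityMeasure_gammaMeasure one_pos one_pos

/-- Absence of atoms makes each level set of the product null in `ae_mul_ne_gainLaw`. -/
instance : NullSingletonClass (gammaMeasure 1 1) := nullSingletonClass_withDensity _

theorem integrable_gammaMeasure_one_one {f : ℝ → ℂ} : Integrable f (gammaMeasure 1 1) ↔
    IntegrableOn (fun x => (Real.exp (-x) : ℂ) * f x) (Ioi 0) := by
  rw [gammaMeasure_one_one, integrable_withDensity_iff_integrable_smul' (by fun_prop) (by simp)]
  simp only [ENNReal.toReal_ofReal (Real.exp_pos _).le, Complex.real_smul]
  rfl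

theorem integral_gammaMeasure_one_one (f : ℝ → ℂ) : ∫ x, f x ∂(gammaMeasure 1 1) =
    ∫ x in Ioi 0, (Real.exp (-x) : ℂ) * f x := by
  rw [gammaMeasure_one_one, integral_withDensity_eq_integral_toReal_smul (by fun_prop) (by simp)]
  simp only [ENNReal.toReal_ofReal (Real.exp_pos _).le, Complex.real_smul]

theorem ae_pos_gammaMeasure_one_one : ∀ᵐ x ∂(gammaMeasure 1 1), 0 < x := by
  rw [gammaMeasure_one_one]
  exact (withDensity_absolutelyContinuous _ _).ae_le (ae_restrict_mem measurableSet_Ioi)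

theorem integrable_cpow_gammaMeasure_one_one {s : ℂ} (hs : -1 < s.re) :
    Integrable (fun x : ℝ => (x : ℂ) ^ s) (gammaMeasure 1 1) := by
  rw [integrable_gammaMeasure_one_one]
  have := Complex.GammaIntegral_convergent (s := s + 1) (by simp; linarith)
  simpa using! this

theorem integral_cpow_gammaMeasure_one_one {s : ℂ} (hs : -1 < s.re) :
    ∫ x : ℝ, (x : ℂ) ^ s ∂(gammaMeasure 1 1) = Complex.Gamma (s + 1) := by
  rw [integral_gammaMeasure_one_one, Complex.Gamma_eq_integral (by simp; linarith),
    Complex.GammaIntegral]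
  simp

/-- The joint law of two independent unit exponential power gains. -/
noncomputable abbrev gainLaw : Measure (ℝ × ℝ) := (gammaMeasure 1 1).prod (gammaMeasure 1 1)

theorem ae_pos_gainLaw : ∀ᵐ p ∂gainLaw, 0 < p.1 ∧ 0 < p.2 := by
  filter_upwards [Measure.quasiMeasurePreserving_fst.ae ae_pos_gammaMeasure_one_one,
    Measure.quasiMeasurePreserving_snd.ae ae_pos_gammaMeasure_one_one] with p h1 h2
  exact ⟨h1, h2⟩

theorem cpow_mul_ae_eq_gainLaw (s : ℂ) : (fun p : ℝ × ℝ => (((p.1 * p.2)⁻¹ : ℝ) : ℂ) ^ (-s))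
    =ᵐ[gainLaw] fun p => (p.1 : ℂ) ^ s * (p.2 : ℂ) ^ s := by
  filter_upwards [ae_pos_gainLaw] with p hp
  rw [← Complex.mul_cpow_ofReal_nonneg hp.1.le hp.2.le, Complex.cpow_neg, Complex.ofReal_inv,
    Complex.inv_cpow, inv_inv, Complex.ofReal_mul]
  rw [Complex.arg_ofReal_of_nonneg (mul_pos hp.1 hp.2).le]
  exact Real.pi_pos.ne

theorem integrable_inv_cpow_gainLaw {s : ℂ} (hs : -1 < s.re) :
    Integrable (fun p : ℝ × ℝ => (((p.1 * p.2)⁻¹ : ℝ) : ℂ) ^ (-s)) gainLaw :=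
  ((integrable_cpow_gammaMeasure_one_one hs).mul_prod
    (integrable_cpow_gammaMeasure_one_one hs)).congr (cpow_mul_ae_eq_gainLaw s).symm

theorem integral_inv_cpow_gainLaw {s : ℂ} (hs : -1 < s.re) :
    ∫ p : ℝ × ℝ, (((p.1 * p.2)⁻¹ : ℝ) : ℂ) ^ (-s) ∂gainLaw = Complex.Gamma (s + 1) ^ 2 := by
  rw [integral_congr_ae (cpow_mul_ae_eq_gainLaw s),
    integral_prod_mul (fun x : ℝ => (x : ℂ) ^ s) (fun x : ℝ => (x : ℂ) ^ s),
    integral_cpow_gammaMeasure_one_one hs, sq]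

theorem measurable_gainLaw_inv : Measurable (fun p : ℝ × ℝ => (p.1 * p.2)⁻¹) := by fun_prop

/-- The dilation factor is `1 / (X * Y)`, and by independence `E (X * Y) ^ s` splits into two Gamma
integrals. -/
theorem hasMellin_gainLaw {f : ℝ → ℂ} (hfm : Measurable f) {s : ℂ} (hs : -1 < s.re)
    (hf : MellinConvergent f s) :
    HasMellin (fun x => ∫ p, f ((p.1 * p.2)⁻¹ * x) ∂gainLaw) s
      (Complex.Gamma (s + 1) ^ 2 * mellin f s) := by
  have := hasMellin_integral_smul_comp_mul_left (μ := gainLaw) (w := fun _ => 1)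
    measurable_const measurable_gainLaw_inv
    (ae_pos_gainLaw.mono fun p hp => inv_pos.2 (mul_pos hp.1 hp.2)) hfm hf
    (by simpa only [one_mul] using integrable_inv_cpow_gainLaw hs)
  simpa only [one_mul, integral_inv_cpow_gainLaw hs] using this

/-! ### Mellin transforms of the two kernels -/

theorem hasMellin_indicator_Ici_one {s : ℂ} (hs : s.re < 0) :
    HasMellin ((Ici (1 : ℝ)).indicator fun _ => (1 : ℂ)) s (-1 / s) := by
  have e : (fun t : ℝ => (t : ℂ) ^ (s - 1) • (Ici (1 : ℝ)).indicator (fun _ => (1 : ℂ)) t) =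
      (Ici (1 : ℝ)).indicator (fun t : ℝ => (t : ℂ) ^ (s - 1)) := by
    ext t
    by_cases ht : t ∈ Ici (1 : ℝ) <;> simp [ht, indicator]
  have hsub : Ici (1 : ℝ) ⊆ Ioi 0 := fun t (ht : 1 ≤ t) => lt_of_lt_of_le one_pos ht
  have h1 : (s - 1).re < -1 := by simp; linarith
  rw [HasMellin, MellinConvergent, mellin, e]
  constructor
  · refine Integrable.integrableOn ?_
    rw [integrable_indicator_iff measurableSet_Ici, integrableOn_Ici_iff_integrableOn_Ioi]
    exact integrableOn_Ioi_cpow_of_lt h1 one_pos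
  · rw [setIntegral_indicator measurableSet_Ici, inter_eq_right.2 hsub,
      integral_Ici_eq_integral_Ioi, integral_Ioi_cpow_of_lt h1 one_pos]
    simp

theorem hasMellin_exp_neg {s : ℂ} (hs : 0 < s.re) :
    HasMellin (fun x : ℝ => (Real.exp (-x) : ℂ)) s (Complex.Gamma s) := by
  constructor
  · have := Complex.GammaIntegral_convergent hs
    simpa only [MellinConvergent, smul_eq_mul, mul_comm] using! this
  · rw [Complex.Gamma_eq_integral hs, Complex.GammaIntegral_eq_mellin]

theorem integral_exp_neg_mul_gammaMeasure_one_one {x : ℝ} (hx : 0 < x) :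
    ∫ t : ℝ, (Real.exp (-(t * x)) : ℂ) ∂(gammaMeasure 1 1) = ((1 + x)⁻¹ : ℝ) := by
  rw [integral_gammaMeasure_one_one]
  have : ∀ t : ℝ, (Real.exp (-t) : ℂ) * (Real.exp (-(t * x)) : ℂ) =
      (Real.exp (-(1 + x) * t) : ℝ) := by
    intro t
    rw [← Complex.ofReal_mul, ← Real.exp_add]
    ring_nf
  simp_rw [this]
  rw [integral_complex_ofReal, integral_exp_mul_Ioi (by linarith)]
  rw [mul_zero, Real.exp_zero, neg_div_neg_eq, one_div]

/-- The function is the Laplace transform of the exponential law, hence an average of dilates of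
`exp (-x)`: the kernel gives `Γ(s)` and the moment of order `-s` gives `Γ(1 - s)`. -/
theorem hasMellin_inv_one_add {s : ℂ} (h0 : 0 < s.re) (h1 : s.re < 1) :
    HasMellin (fun x : ℝ => (((1 + x)⁻¹ : ℝ) : ℂ)) s
      (Complex.Gamma s * Complex.Gamma (1 - s)) := by
  have hs : -1 < (-s).re := by simp; linarith
  have := hasMellin_integral_smul_comp_mul_left (μ := gammaMeasure 1 1) (w := fun _ => 1)
    (φ := fun t => t) (f := fun x : ℝ => (Real.exp (-x) : ℂ)) (s := s)
    measurable_const measurable_id ae_pos_gammaMeasure_one_one (by fun_prop)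
    (hasMellin_exp_neg h0).1
    (by simpa only [one_mul] using integrable_cpow_gammaMeasure_one_one hs)
  simp only [one_mul, integral_cpow_gammaMeasure_one_one hs, (hasMellin_exp_neg h0).2] at this
  rw [mul_comm, sub_eq_neg_add]
  have e : ∀ x ∈ Ioi (0 : ℝ), (x : ℂ) ^ (s - 1) • (((1 + x)⁻¹ : ℝ) : ℂ) = (x : ℂ) ^ (s - 1) •
      ∫ t : ℝ, (Real.exp (-(t * x)) : ℂ) ∂(gammaMeasure 1 1) := fun x hx => by
    rw [integral_exp_neg_mul_gammaMeasure_one_one hx]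
  constructor
  · exact (integrableOn_congr_fun e measurableSet_Ioi).2 this.1
  · rw [← this.2]
    exact setIntegral_congr_fun measurableSet_Ioi e

theorem integral_inv_mul_inv_one_add {x : ℝ} (hx : 0 < x) :
    ∫ t in Ioc (0 : ℝ) 1, ((t⁻¹ : ℝ) : ℂ) * (((1 + t⁻¹ * x)⁻¹ : ℝ) : ℂ) =
      (Real.log (1 + x⁻¹) : ℝ) := by
  have e : ∀ t ∈ Ioc (0 : ℝ) 1, ((t⁻¹ : ℝ) : ℂ) * (((1 + t⁻¹ * x)⁻¹ : ℝ) : ℂ) =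
      (((t + x)⁻¹ : ℝ) : ℂ) := fun t ht => by
    have := ht.1
    rw [← Complex.ofReal_mul, ← mul_inv, mul_add, mul_one, mul_inv_cancel_left₀ this.ne']
  rw [setIntegral_congr_fun measurableSet_Ioc e, integral_complex_ofReal,
    ← intervalIntegral.integral_of_le zero_le_one,
    intervalIntegral.integral_comp_add_right (fun t => t⁻¹),
    integral_inv_of_pos (by simpa) (by linarith)]
  congr 2
  field_simp
  ring

/-- Since `log (1 + 1 / x)` is the integral of `1 / (t + x)` over `0 < t ≤ 1`, it averages the
dilates of `1 / (1 + x)` by `1 / t` with weight `1 / t`; the factor `1 / s` is the integral of `t ^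
(s - 1)`. -/
theorem hasMellin_log_one_add_inv {s : ℂ} (h0 : 0 < s.re) (h1 : s.re < 1) :
    HasMellin (fun x : ℝ => (Real.log (1 + x⁻¹) : ℂ)) s
      (1 / s * (Complex.Gamma s * Complex.Gamma (1 - s))) := by
  have hw : ∀ t ∈ Ioc (0 : ℝ) 1, ((t⁻¹ : ℝ) : ℂ) * ((t⁻¹ : ℝ) : ℂ) ^ (-s) = (t : ℂ) ^ (s - 1) :=
    fun t ht => by
      rw [Complex.cpow_neg, Complex.ofReal_inv, Complex.inv_cpow, inv_inv,
        Complex.cpow_sub _ _ (by simpa using ht.1.ne'), Complex.cpow_one, div_eq_inv_mul]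
      rw [Complex.arg_ofReal_of_nonneg ht.1.le]
      exact Real.pi_pos.ne
  have hI : IntegrableOn (fun t : ℝ => (t : ℂ) ^ (s - 1)) (Ioc 0 1) := by
    rw [← intervalIntegrable_iff_integrableOn_Ioc_of_le zero_le_one]
    exact intervalIntegral.intervalIntegrable_cpow' (by simp; linarith)
  have := hasMellin_integral_smul_comp_mul_left (μ := volume.restrict (Ioc (0 : ℝ) 1))
    (w := fun t => ((t⁻¹ : ℝ) : ℂ)) (φ := fun t => t⁻¹) (f := fun x : ℝ => (((1 + x)⁻¹ : ℝ) : ℂ))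
    (s := s) (by fun_prop) measurable_inv
    ((ae_restrict_mem measurableSet_Ioc).mono fun t ht => inv_pos.2 ht.1) (by fun_prop)
    (hasMellin_inv_one_add h0 h1).1
    ((integrableOn_congr_fun hw measurableSet_Ioc).2 hI)
  rw [setIntegral_congr_fun measurableSet_Ioc hw, ← intervalIntegral.integral_of_le zero_le_one,
    integral_cpow (Or.inl (by simp; linarith)), (hasMellin_inv_one_add h0 h1).2, sub_add_cancel,
    Complex.ofReal_one, Complex.one_cpow, Complex.ofReal_zero,
    Complex.zero_cpow (fun h => by simp [h] at h0), sub_zero] at this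
  have e : ∀ x ∈ Ioi (0 : ℝ), (x : ℂ) ^ (s - 1) • (Real.log (1 + x⁻¹) : ℂ) = (x : ℂ) ^ (s - 1) •
      ∫ t in Ioc (0 : ℝ) 1, ((t⁻¹ : ℝ) : ℂ) * (((1 + t⁻¹ * x)⁻¹ : ℝ) : ℂ) := fun x hx => by
    rw [integral_inv_mul_inv_one_add hx]
  constructor
  · exact (integrableOn_congr_fun e measurableSet_Ioi).2 this.1
  · rw [← this.2]
    exact setIntegral_congr_fun measurableSet_Ioi e

/-! ### Decay of Gamma on vertical lines -/

theorem norm_Gamma_le_Gamma_re {s : ℂ} (hs : 0 < s.re) :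
    ‖Complex.Gamma s‖ ≤ Real.Gamma s.re := by
  rw [Complex.Gamma_eq_integral hs, Complex.GammaIntegral, Real.Gamma_eq_integral hs]
  refine (norm_integral_le_integral_norm _).trans (le_of_eq ?_)
  refine setIntegral_congr_fun measurableSet_Ioi fun x (hx : 0 < x) => ?_
  simp only [norm_mul]
  rw [Complex.norm_cpow_eq_rpow_re_of_pos hx, Complex.norm_real,
    Real.norm_of_nonneg (Real.exp_pos _).le]
  simp

theorem continuous_Gamma_vertical {σ : ℝ} (hσ : 0 < σ) :
    Continuous fun t : ℝ => Complex.Gamma (σ + t * Complex.I) := by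
  refine continuous_iff_continuousAt.2 fun t => ?_
  refine ContinuousAt.comp (f := fun t : ℝ => (σ + t * Complex.I : ℂ)) (g := Complex.Gamma)
    (Complex.differentiableAt_Gamma _ fun m h => ?_).continuousAt (by fun_prop)
  have := congrArg Complex.re h
  simp at this
  have : (0 : ℝ) ≤ m := m.cast_nonneg
  linarith

/-- Quadratic decay suffices, and two steps of the functional equation give it: `Γ(s + 2) = (s + 1)
* s * Γ(s)` is bounded on the line, while `‖s + 1‖ * ‖s‖ ≥ σ ^ 2 + t ^ 2`. -/
theorem integrable_Gamma_vertical {σ : ℝ} (hσ : 0 < σ) :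
    Integrable fun t : ℝ => Complex.Gamma (σ + t * Complex.I) := by
  have hm : 0 < min 1 (σ ^ 2) := by positivity
  refine (integrable_inv_one_add_sq.const_mul (Real.Gamma (σ + 2) / min 1 (σ ^ 2))).mono'
    (continuous_Gamma_vertical hσ).aestronglyMeasurable (ae_of_all _ fun t => ?_)
  set s : ℂ := σ + t * Complex.I with hs
  have hre : s.re = σ := by simp [hs]
  have him : s.im = t := by simp [hs]
  have h0 : s ≠ 0 := fun h => by simp [h] at hre; linarith
  have h1 : s + 1 ≠ 0 := fun h => by
    have := congrArg Complex.re h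
    simp [hre] at this
    linarith
  have e : Complex.Gamma (s + 2) = (s + 1) * (s * Complex.Gamma s) := by
    rw [← Complex.Gamma_add_one s h0, ← Complex.Gamma_add_one _ h1]
    ring_nf
  have hb : ‖Complex.Gamma (s + 2)‖ ≤ Real.Gamma (σ + 2) := by
    have := norm_Gamma_le_Gamma_re (s := s + 2) (by simp [hre]; linarith)
    simpa [hre] using this
  have hn : ‖s‖ ^ 2 = σ ^ 2 + t ^ 2 := by
    rw [Complex.sq_norm, Complex.normSq_apply, hre, him]; ring
  have hn1 : ‖s‖ ≤ ‖s + 1‖ := by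
    refine le_of_sq_le_sq ?_ (norm_nonneg _)
    rw [hn, Complex.sq_norm, Complex.normSq_apply]
    simp [hre, him]
    nlinarith
  have hlow : min 1 (σ ^ 2) * (1 + t ^ 2) ≤ ‖s + 1‖ * ‖s‖ := by
    have a1 : min 1 (σ ^ 2) ≤ 1 := min_le_left _ _
    have a2 : min 1 (σ ^ 2) ≤ σ ^ 2 := min_le_right _ _
    nlinarith [mul_le_mul_of_nonneg_right hn1 (norm_nonneg s), sq_nonneg t,
      mul_le_mul_of_nonneg_right a1 (sq_nonneg t)]
  rw [e, norm_mul, norm_mul, ← mul_assoc] at hb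
  have hpos : 0 < min 1 (σ ^ 2) * (1 + t ^ 2) := by positivity
  rw [← div_eq_mul_inv, div_div, le_div_iff₀ hpos, mul_comm]
  exact (mul_le_mul_of_nonneg_right hlow (norm_nonneg _)).trans hb

/-- Once one factor is integrable, the other Gamma factors need only be bounded. -/
theorem MeasureTheory.Integrable.mul_Gamma_vertical {g : ℝ → ℂ} (hg : Integrable g) {σ : ℝ}
    (hσ : 0 < σ) : Integrable fun t : ℝ => g t * Complex.Gamma (σ + t * Complex.I) :=
  hg.mul_bdd (c := Real.Gamma σ) (continuous_Gamma_vertical hσ).aestronglyMeasurable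
    (ae_of_all _ fun t => by
      simpa using norm_Gamma_le_Gamma_re (s := σ + t * Complex.I) (by simpa using hσ))

/-! ### Meijer G-values by Mellin inversion -/

/-- A Mellin-Barnes integral is evaluated by Mellin inversion. -/
theorem hasMeijerG_of_mellin {p q m n : ℕ} {a : Fin p → ℂ} {b : Fin q → ℂ} {f : ℝ → ℂ} {x : ℝ}
    (hx : 0 < x) (hsep : ∃ c : ℝ, MeijerSeparates m n a b c)
    (hconv : ∀ c : ℝ, MeijerSeparates m n a b c → MellinConvergent f c)
    (hint : ∀ c : ℝ, MeijerSeparates m n a b c → Complex.VerticalIntegrable (mellin f) c)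
    (heq : ∀ c : ℝ, MeijerSeparates m n a b c → ∀ t : ℝ,
      meijerIntegrand m n a b x (c + t * Complex.I) =
        (x : ℂ) ^ (-(c + t * Complex.I)) * mellin f (c + t * Complex.I))
    (hcont : ContinuousAt f x) : HasMeijerG m n a b x (f x) := by
  refine ⟨hsep, fun c hc => ?_⟩
  have hx' : (x : ℂ) ≠ 0 := by exact_mod_cast hx.ne'
  simp_rw [heq c hc]
  constructor
  · refine (hint c hc).bdd_mul (c := x ^ (-c)) ?_ (ae_of_all _ fun t => ?_)
    · refine Continuous.aestronglyMeasurable ?_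
      exact Continuous.const_cpow (by fun_prop) (Or.inl hx')
    · rw [Complex.norm_cpow_eq_rpow_re_of_pos hx]
      simp
  · have := mellinInv_mellin_eq c f hx (hconv c hc) (hint c hc) hcont
    rw [← this, mellinInv]
    simp [Complex.real_smul]

theorem meijerSeparates_three_one {c : ℝ} :
    MeijerSeparates 3 1 ![(0 : ℂ)] ![(0 : ℂ), 0, 1] c ↔ 0 < c ∧ c < 1 := by
  simp [MeijerSeparates, Fin.forall_fin_succ]
  grind

theorem meijerSeparates_two_one {c : ℝ} :
    MeijerSeparates 2 1 ![(1 : ℂ)] ![(1 : ℂ), 1, 0] c ↔ -1 < c ∧ c < 0 := by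
  simp [MeijerSeparates, Fin.forall_fin_succ]

theorem meijerIntegrand_three_one (z s : ℂ) :
    meijerIntegrand 3 1 ![(0 : ℂ)] ![(0 : ℂ), 0, 1] z s =
      Complex.Gamma s * Complex.Gamma s * Complex.Gamma (1 + s) * Complex.Gamma (1 - s) *
        z ^ (-s) := by
  simp [meijerIntegrand, Fin.prod_univ_succ]
  left; left; ring

theorem meijerIntegrand_two_one (z s : ℂ) :
    meijerIntegrand 2 1 ![(1 : ℂ)] ![(1 : ℂ), 1, 0] z s =
      Complex.Gamma (1 + s) * Complex.Gamma (1 + s) * (Complex.Gamma (1 - s))⁻¹ *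
        Complex.Gamma (-s) * z ^ (-s) := by
  simp [meijerIntegrand, Fin.prod_univ_succ]
  left; left; ring

/-! ### The two averaged functions as G-functions -/

/-- The distribution function of the product of two independent unit exponential gains. -/
noncomputable def gainProductCDF (x : ℝ) : ℂ :=
  ∫ p : ℝ × ℝ, (Ici (1 : ℝ)).indicator (fun _ => (1 : ℂ)) ((p.1 * p.2)⁻¹ * x) ∂gainLaw

/-- The mean of `log (1 + X Y / x)` for independent unit exponential gains `X`, `Y`. -/
noncomputable def meanLogGain (x : ℝ) : ℂ :=
  ∫ p : ℝ × ℝ, (Real.log (1 + ((p.1 * p.2)⁻¹ * x)⁻¹) : ℂ) ∂gainLaw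

theorem hasMellin_gainProductCDF {s : ℂ} (h0 : -1 < s.re) (h1 : s.re < 0) :
    HasMellin gainProductCDF s (Complex.Gamma (s + 1) ^ 2 * (-1 / s)) := by
  have := hasMellin_gainLaw (measurable_const.indicator measurableSet_Ici) h0
    (hasMellin_indicator_Ici_one h1).1
  rwa [(hasMellin_indicator_Ici_one h1).2] at this

theorem hasMellin_meanLogGain {s : ℂ} (h0 : 0 < s.re) (h1 : s.re < 1) :
    HasMellin meanLogGain s
      (Complex.Gamma (s + 1) ^ 2 * (1 / s * (Complex.Gamma s * Complex.Gamma (1 - s)))) := by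
  have := hasMellin_gainLaw (f := fun x : ℝ => (Real.log (1 + x⁻¹) : ℂ)) (by fun_prop)
    (by linarith) (hasMellin_log_one_add_inv h0 h1).1
  rwa [(hasMellin_log_one_add_inv h0 h1).2] at this

theorem ae_mul_ne_gainLaw {x : ℝ} (hx : 0 < x) : ∀ᵐ p ∂gainLaw, p.1 * p.2 ≠ x := by
  have hm : MeasurableSet {p : ℝ × ℝ | p.1 * p.2 = x} :=
    measurableSet_eq_fun (by fun_prop) measurable_const
  have : gainLaw {p : ℝ × ℝ | p.1 * p.2 = x} = 0 := by
    rw [Measure.measure_prod_null hm]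
    refine ae_of_all _ fun a => ?_
    refine Set.Subsingleton.measure_zero (fun y hy z hz => ?_) _
    have hy' : a * y = x := hy
    have hz' : a * z = x := hz
    have ha : a ≠ 0 := fun h => by simp [h] at hy'; linarith
    exact mul_left_cancel₀ ha (hy'.trans hz'.symm)
  rw [ae_iff]
  simpa using this

/-- Pointwise Mellin inversion needs continuity. The indicator jumps only on the null event `p.1 *
p.2 = x`, so dominated convergence applies. -/
theorem continuousAt_gainProductCDF {x : ℝ} (hx : 0 < x) : ContinuousAt gainProductCDF x := by
  refine continuousAt_of_dominated (bound := fun _ => 1) ?_ ?_ (integrable_const _) ?_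
  · refine Eventually.of_forall fun y => Measurable.aestronglyMeasurable ?_
    exact (measurable_const.indicator measurableSet_Ici).comp (by fun_prop)
  · refine Eventually.of_forall fun y => ae_of_all _ fun p => ?_
    refine (norm_indicator_le_norm_self _ _).trans ?_
    simp
  · filter_upwards [ae_mul_ne_gainLaw hx, ae_pos_gainLaw] with p hp hpos
    have hW := mul_pos hpos.1 hpos.2
    have hne : (p.1 * p.2)⁻¹ * x ≠ 1 := fun h => hp (by field_simp at h; exact ((div_eq_one_iff_eq hW.ne').1 h).symm)
    refine ContinuousAt.comp (f := fun y : ℝ => (p.1 * p.2)⁻¹ * y)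
      (g := (Ici (1 : ℝ)).indicator fun _ => (1 : ℂ)) ?_ (by fun_prop)
    rcases lt_or_gt_of_ne hne with h | h
    · refine (continuousAt_const (y := (0 : ℂ))).congr ?_
      filter_upwards [Iio_mem_nhds h] with y hy
      exact (indicator_of_notMem (not_le.2 hy) _).symm
    · refine (continuousAt_const (y := (1 : ℂ))).congr ?_
      filter_upwards [Ioi_mem_nhds h] with y hy
      exact (indicator_of_mem (mem_Ici.2 (le_of_lt hy)) (fun _ => (1 : ℂ))).symm

theorem integrable_mul_gainLaw : Integrable (fun p : ℝ × ℝ => p.1 * p.2) gainLaw := by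
  have h : Integrable (fun x : ℝ => x) (gammaMeasure 1 1) := by
    have := (integrable_cpow_gammaMeasure_one_one (s := 1) (by norm_num)).re
    simpa using! this
  exact h.mul_prod h

theorem log_one_add_bounds {u : ℝ} (hu : 0 ≤ u) :
    0 ≤ Real.log (1 + u) ∧ Real.log (1 + u) ≤ u :=
  ⟨Real.log_nonneg (by linarith), by linarith [Real.log_le_sub_one_of_pos (by linarith : 0 < 1 + u)]⟩

theorem norm_log_gain_le {p : ℝ × ℝ} (hp : 0 < p.1 ∧ 0 < p.2) {x y : ℝ} (hx : 0 < x)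
    (hxy : x ≤ y) : ‖Real.log (1 + ((p.1 * p.2)⁻¹ * y)⁻¹)‖ ≤ p.1 * p.2 * x⁻¹ := by
  have hW := mul_pos hp.1 hp.2
  have hy := hx.trans_le hxy
  have h := log_one_add_bounds (u := ((p.1 * p.2)⁻¹ * y)⁻¹) (by positivity)
  rw [Real.norm_of_nonneg h.1]
  refine h.2.trans ?_
  rw [mul_inv, inv_inv]
  gcongr

theorem integrable_log_gain {x : ℝ} (hx : 0 < x) :
    Integrable (fun p : ℝ × ℝ => Real.log (1 + ((p.1 * p.2)⁻¹ * x)⁻¹)) gainLaw := by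
  refine (integrable_mul_gainLaw.mul_const x⁻¹).mono'
    (Measurable.aestronglyMeasurable (by fun_prop)) ?_
  filter_upwards [ae_pos_gainLaw] with p hp
  exact norm_log_gain_le hp hx le_rfl

theorem continuousAt_meanLogGain {x : ℝ} (hx : 0 < x) : ContinuousAt meanLogGain x := by
  -- For `y > x / 2`, the bound `log (1 + u) ≤ u` gives a majorant independent of `y`.
  refine continuousAt_of_dominated (bound := fun p => p.1 * p.2 * (x / 2)⁻¹) ?_ ?_
    (integrable_mul_gainLaw.mul_const _) ?_
  · exact Eventually.of_forall fun y => Measurable.aestronglyMeasurable (by fun_prop)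
  · filter_upwards [Ioi_mem_nhds (half_lt_self hx)] with y hy
    filter_upwards [ae_pos_gainLaw] with p hp
    rw [Complex.norm_real]
    exact norm_log_gain_le hp (half_pos hx) (le_of_lt hy)
  · filter_upwards [ae_pos_gainLaw] with p hp
    have hW := mul_pos hp.1 hp.2
    have h1 : (p.1 * p.2)⁻¹ * x ≠ 0 := by positivity
    have h2 : 1 + ((p.1 * p.2)⁻¹ * x)⁻¹ ≠ 0 := by positivity
    refine Complex.continuous_ofReal.continuousAt.comp ?_
    refine ContinuousAt.log ?_ h2
    refine continuousAt_const.add (ContinuousAt.inv₀ (by fun_prop) h1)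

/-- Here `Γ(-s) / Γ(1 - s) = -1 / s`, which is the transform of the indicator. -/
theorem hasMeijerG_gainProductCDF {x : ℝ} (hx : 0 < x) :
    HasMeijerG 2 1 ![1] ![1, 1, 0] (x : ℂ) (gainProductCDF x) := by
  refine hasMeijerG_of_mellin hx ⟨-1 / 2, meijerSeparates_two_one.2 (by norm_num)⟩
    (fun c hc => ?_) (fun c hc => ?_) (fun c hc t => ?_) (continuousAt_gainProductCDF hx)
  · rw [meijerSeparates_two_one] at hc
    exact (hasMellin_gainProductCDF (by simpa using hc.1) (by simpa using hc.2)).1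
  · rw [meijerSeparates_two_one] at hc
    -- The factor `-1 / s` is bounded because `‖s‖ ≥ |c|` on the line and `c < 0`.
    have h := ((integrable_Gamma_vertical (σ := c + 1) (by linarith)).mul_Gamma_vertical
      (σ := c + 1) (by linarith)).mul_bdd (g := fun t : ℝ => -1 / (c + t * Complex.I)) (c := |c|⁻¹)
      (Measurable.aestronglyMeasurable (by fun_prop)) (ae_of_all _ fun t => ?_)
    · refine h.congr (ae_of_all _ fun t => ?_)
      dsimp only
      rw [(hasMellin_gainProductCDF (by simpa using hc.1) (by simpa using hc.2)).2, sq]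
      push_cast
      ring_nf
    · rw [norm_div, norm_neg, norm_one, one_div]
      have hc0 : 0 < |c| := abs_pos.2 hc.2.ne
      gcongr
      simpa using Complex.abs_re_le_norm (c + t * Complex.I)
  · rw [meijerSeparates_two_one] at hc
    have hs : (c + t * Complex.I) ≠ 0 := fun h => by
      have := congrArg Complex.re h
      simp at this
      linarith
    have hG : Complex.Gamma (-(c + t * Complex.I)) ≠ 0 :=
      Complex.Gamma_ne_zero_of_re_pos (by simpa using hc.2)
    rw [(hasMellin_gainProductCDF (by simpa using hc.1) (by simpa using hc.2)).2,
      meijerIntegrand_two_one, sub_eq_neg_add, Complex.Gamma_add_one _ (neg_ne_zero.2 hs),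
      add_comm 1]
    generalize (c + t * Complex.I : ℂ) = s at *
    field_simp

theorem hasMeijerG_meanLogGain {x : ℝ} (hx : 0 < x) :
    HasMeijerG 3 1 ![0] ![0, 0, 1] (x : ℂ) (meanLogGain x) := by
  have key : ∀ c : ℝ, 0 < c ∧ c < 1 → ∀ t : ℝ, mellin meanLogGain (c + t * Complex.I) =
      Complex.Gamma (c + t * Complex.I) * Complex.Gamma (c + t * Complex.I) *
        Complex.Gamma (1 + (c + t * Complex.I)) * Complex.Gamma (1 - (c + t * Complex.I)) := by
    intro c hc t
    have hs : (c + t * Complex.I) ≠ 0 := fun h => by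
      have := congrArg Complex.re h
      simp at this
      linarith
    rw [(hasMellin_meanLogGain (by simpa using hc.1) (by simpa using hc.2)).2, add_comm 1,
      Complex.Gamma_add_one _ hs]
    generalize (c + t * Complex.I : ℂ) = s at *
    field_simp
  refine hasMeijerG_of_mellin hx ⟨1 / 2, meijerSeparates_three_one.2 (by norm_num)⟩
    (fun c hc => ?_) (fun c hc => ?_) (fun c hc t => ?_) (continuousAt_meanLogGain hx)
  · rw [meijerSeparates_three_one] at hc
    exact (hasMellin_meanLogGain (by simpa using hc.1) (by simpa using hc.2)).1
  · rw [meijerSeparates_three_one] at hc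
    -- The factor `Γ(1 - s)` runs along its line with `-t`, hence the two reflections.
    have h := (((integrable_Gamma_vertical hc.1).mul_Gamma_vertical hc.1).mul_Gamma_vertical
      (σ := c + 1) (by linarith)).comp_neg.mul_Gamma_vertical (σ := 1 - c) (by linarith)
    refine h.comp_neg.congr (ae_of_all _ fun t => ?_)
    dsimp only
    rw [key c hc]
    push_cast
    ring_nf
  · rw [key c (meijerSeparates_three_one.1 hc), meijerIntegrand_three_one, mul_comm]

/-! ### The logarithm as a weighted tail integral -/

/-- The tail of the distribution of `X Y / r`, before averaging, weighted by `1 / (z + 1)`. -/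
noncomputable def weightedTail (r : ℝ) (p : ℝ × ℝ) (z : ℝ) : ℝ :=
  (Iio (1 : ℝ)).indicator (fun _ => (1 : ℝ)) ((p.1 * p.2)⁻¹ * (r * z)) * (z + 1)⁻¹

theorem measurable_weightedTail (r : ℝ) :
    Measurable fun q : (ℝ × ℝ) × ℝ => weightedTail r q.1 q.2 := by
  refine Measurable.mul ?_ (by fun_prop)
  exact (measurable_const.indicator measurableSet_Iio).comp
    (g := (Iio (1 : ℝ)).indicator fun _ => (1 : ℝ)) (by fun_prop)

theorem weightedTail_nonneg (r : ℝ) (p : ℝ × ℝ) {z : ℝ} (hz : 0 < z) : 0 ≤ weightedTail r p z :=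
  mul_nonneg (indicator_nonneg (fun _ _ => zero_le_one) _) (by positivity)

theorem weightedTail_eq_indicator {r : ℝ} (hr : 0 < r) {p : ℝ × ℝ} (hp : 0 < p.1 ∧ 0 < p.2)
    (z : ℝ) : weightedTail r p z =
      (Iio ((p.1 * p.2)⁻¹ * r)⁻¹).indicator (fun z => (z + 1)⁻¹) z := by
  have hW := mul_pos hp.1 hp.2
  have hiff : (p.1 * p.2)⁻¹ * (r * z) < 1 ↔ z < ((p.1 * p.2)⁻¹ * r)⁻¹ := by
    rw [← mul_assoc, mul_comm, ← lt_div_iff₀ (by positivity), one_div]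
  by_cases h : z < ((p.1 * p.2)⁻¹ * r)⁻¹
  · rw [weightedTail, indicator_of_mem (mem_Iio.2 (hiff.2 h)), indicator_of_mem (mem_Iio.2 h),
      one_mul]
  · rw [weightedTail, indicator_of_notMem (s := Iio 1) (fun h' => h (hiff.1 h')),
      indicator_of_notMem (s := Iio _) h,
      zero_mul]

theorem integrableOn_inv_add_one (b : ℝ) : IntegrableOn (fun z : ℝ => (z + 1)⁻¹) (Ioo 0 b) := by
  refine (ContinuousOn.integrableOn_Icc ?_).mono_set Ioo_subset_Icc_self
  intro z hz
  have := hz.1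
  exact (ContinuousAt.inv₀ (by fun_prop) (by positivity)).continuousWithinAt

theorem integrableOn_weightedTail {r : ℝ} (hr : 0 < r) {p : ℝ × ℝ} (hp : 0 < p.1 ∧ 0 < p.2) :
    IntegrableOn (weightedTail r p) (Ioi 0) := by
  rw [show weightedTail r p = _ from funext (weightedTail_eq_indicator hr hp), IntegrableOn,
    integrable_indicator_iff measurableSet_Iio, IntegrableOn, Measure.restrict_restrict
    measurableSet_Iio, Iio_inter_Ioi]
  exact integrableOn_inv_add_one _

theorem integral_weightedTail {r : ℝ} (hr : 0 < r) {p : ℝ × ℝ} (hp : 0 < p.1 ∧ 0 < p.2) :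
    ∫ z in Ioi 0, weightedTail r p z = Real.log (1 + ((p.1 * p.2)⁻¹ * r)⁻¹) := by
  have hW := mul_pos hp.1 hp.2
  have hb : 0 < ((p.1 * p.2)⁻¹ * r)⁻¹ := by positivity
  simp_rw [weightedTail_eq_indicator hr hp]
  rw [setIntegral_indicator measurableSet_Iio, Ioi_inter_Iio, ← integral_Ioc_eq_integral_Ioo,
    ← intervalIntegral.integral_of_le hb.le,
    intervalIntegral.integral_comp_add_right (fun z => z⁻¹),
    integral_inv_of_pos (by norm_num) (by linarith), zero_add, div_one, add_comm]

/-- By nonnegativity the inner integral of the norm is the logarithm itself, which is integrable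
against `gainLaw`; this licenses the exchange in `rateIntegral_one`. -/
theorem integrable_weightedTail_prod {r : ℝ} (hr : 0 < r) :
    Integrable (fun q : (ℝ × ℝ) × ℝ => (weightedTail r q.1 q.2 : ℂ))
      (gainLaw.prod (volume.restrict (Ioi 0))) := by
  refine Integrable.ofReal (f := fun q : (ℝ × ℝ) × ℝ => weightedTail r q.1 q.2) ?_
  rw [integrable_prod_iff (measurable_weightedTail r).aestronglyMeasurable]
  constructor
  · filter_upwards [ae_pos_gainLaw] with p hp
    exact integrableOn_weightedTail hr hp
  · refine (integrable_log_gain hr).congr ?_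
    filter_upwards [ae_pos_gainLaw] with p hp
    rw [← integral_weightedTail hr hp]
    exact setIntegral_congr_fun measurableSet_Ioi fun z hz =>
      (Real.norm_of_nonneg (weightedTail_nonneg r p hz)).symm

theorem integral_weightedTail_gainLaw (r z : ℝ) :
    ∫ p, (weightedTail r p z : ℂ) ∂gainLaw = 1 / ((z : ℂ) + 1) * (1 - gainProductCDF (r * z)) := by
  have hI : Integrable (fun p : ℝ × ℝ =>
      (Ici (1 : ℝ)).indicator (fun _ => (1 : ℂ)) ((p.1 * p.2)⁻¹ * (r * z))) gainLaw := by
    refine (integrable_const (1 : ℝ)).mono' ?_ (ae_of_all _ fun p => ?_)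
    · exact ((measurable_const.indicator measurableSet_Ici).comp
        (g := (Ici (1 : ℝ)).indicator fun _ => (1 : ℂ)) (by fun_prop)).aestronglyMeasurable
    · exact (norm_indicator_le_norm_self _ _).trans (by simp)
  have h1 : (1 : ℂ) = ∫ _ : ℝ × ℝ, (1 : ℂ) ∂gainLaw := by simp
  rw [gainProductCDF]
  -- The third `1` is the minuend, written as the total mass of `gainLaw`; `Iio 1` and `Ici 1` are
  -- complementary, so the integrands then agree at every `p`.
  nth_rewrite 3 [h1]
  rw [← integral_sub (integrable_const _) hI, ← integral_const_mul]
  congr 1 with p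
  rw [weightedTail]
  by_cases h : (p.1 * p.2)⁻¹ * (r * z) < 1
  · rw [indicator_of_mem (mem_Iio.2 h), indicator_of_notMem (by simpa using h)]
    push_cast
    ring
  · rw [indicator_of_notMem (by simpa using h), indicator_of_mem (by simpa using h)]
    simp

/-! ### Application to the radar link -/

namespace RadarLink

theorem Xi_pos (S : RadarLink) : 0 < S.Xi := by
  have := S.T_pos; have := S.B_pos; have := S.β_pos; have := S.P_BS_pos
  have := S.σ_RCS_pos; have := S.wavelength_pos; have := S.σ_τ_pos
  have := S.k_B_pos; have := S.T_temp_pos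
  unfold Xi C_r gammaSq noise
  positivity

theorem threshold_pos (S : RadarLink) : 0 < S.d_r ^ S.α_r / S.Xi :=
  div_pos (Real.rpow_pos_of_pos S.d_r_pos _) S.Xi_pos

/-- This puts the rate in the form averaged by `meanLogGain`. When `x * y = 0`, the convention `0⁻¹
= 0` makes both sides zero. -/
theorem reir_eq (S : RadarLink) (x y : ℝ) :
    S.reir x y = S.δ / (2 * S.T * Real.log 2) *
      Real.log (1 + ((x * y)⁻¹ * (S.d_r ^ S.α_r / S.Xi))⁻¹) := by
  have h : 2 * S.T * S.β * S.B * S.echoSNR x y =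
      ((x * y)⁻¹ * (S.d_r ^ S.α_r / S.Xi))⁻¹ := by
    rw [mul_inv, inv_inv, inv_div, div_eq_mul_inv, ← Real.rpow_neg S.d_r_pos.le, echoSNR, Xi,
      pathLoss]
    ring
  rw [reir, h, Real.logb]
  field_simp

theorem integrable_reir_gainLaw (S : RadarLink) :
    Integrable (fun p : ℝ × ℝ => S.reir p.1 p.2) gainLaw := by
  simp_rw [reir_eq]
  exact (integrable_log_gain S.threshold_pos).const_mul _

theorem rayleighClosedForm_eq (S : RadarLink) : S.rayleighClosedForm =
    ((S.δ / (2 * S.T * Real.log 2) : ℝ) : ℂ) * meanLogGain (S.d_r ^ S.α_r / S.Xi) := by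
  rw [rayleighClosedForm, (hasMeijerG_meanLogGain S.threshold_pos).meijerG_eq]

theorem rateIntegrand_one (S : RadarLink) {z : ℝ} (hz : 0 < z) : S.rateIntegrand 1 z =
    ∫ p, (weightedTail (S.d_r ^ S.α_r / S.Xi) p z : ℂ) ∂gainLaw := by
  rw [integral_weightedTail_gainLaw, rateIntegrand,
    ← (hasMeijerG_gainProductCDF (mul_pos S.threshold_pos hz)).meijerG_eq]
  simp

theorem integrableOn_rateIntegrand_one (S : RadarLink) :
    IntegrableOn (S.rateIntegrand 1) (Ioi 0) :=
  (integrableOn_congr_fun (fun _ hz => S.rateIntegrand_one hz) measurableSet_Ioi).2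
    (integrable_weightedTail_prod S.threshold_pos).integral_prod_right

theorem rateIntegral_one (S : RadarLink) : S.rateIntegral 1 = S.rayleighClosedForm := by
  rw [rateIntegral, rayleighClosedForm_eq,
    setIntegral_congr_fun measurableSet_Ioi fun _ hz => S.rateIntegrand_one hz,
    ← integral_integral_swap (f := fun p z => (weightedTail (S.d_r ^ S.α_r / S.Xi) p z : ℂ))
      (integrable_weightedTail_prod S.threshold_pos), meanLogGain]
  congr 1
  refine integral_congr_ae ?_
  filter_upwards [ae_pos_gainLaw] with p hp
  rw [integral_complex_ofReal, integral_weightedTail S.threshold_pos hp]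

end RadarLink

theorem hasLaw_gainLaw {Ω : Type*} [MeasurableSpace Ω] {P : Measure Ω} [IsProbabilityMeasure P]
    {h_d h_u : Ω → ℂ} (hd : IsRayleighFading P h_d) (hu : IsRayleighFading P h_u)
    (hindep : IndepFun (fun ω => ‖h_d ω‖ ^ 2) (fun ω => ‖h_u ω‖ ^ 2) P) :
    HasLaw (fun ω => (‖h_d ω‖ ^ 2, ‖h_u ω‖ ^ 2)) gainLaw P where
  aemeasurable := hd.aemeasurable.prodMk hu.aemeasurable
  map_eq := by
    rw [(indepFun_iff_map_prod_eq_prod_map_map hd.aemeasurable hu.aemeasurable).1 hindep,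
      hd.map_eq, hu.map_eq]

/-- Rayleigh fading on both hops of the radar link: the ergodic REIR, and with it the integral form
at `m = 1`, equals the closed form; the other conjuncts say that every expectation, integral and
Meijer G-value in these equations exists. -/
theorem corollary1 {Ω : Type*} [MeasurableSpace Ω] (P : Measure Ω) [IsProbabilityMeasure P]
    (S : RadarLink) (h_d h_u : Ω → ℂ)
    (hd : IsRayleighFading P h_d) (hu : IsRayleighFading P h_u)
    (hindep : IndepFun (fun ω => ‖h_d ω‖ ^ 2) (fun ω => ‖h_u ω‖ ^ 2) P) :
    Integrable (fun ω => S.reir (‖h_d ω‖ ^ 2) (‖h_u ω‖ ^ 2)) P ∧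
    MeijerGConverges 3 1 ![0] ![0, 0, 1] ((S.d_r ^ S.α_r / S.Xi : ℝ) : ℂ) ∧
    ((S.ergodicREIR P h_d h_u : ℝ) : ℂ) = S.rayleighClosedForm ∧
    (∀ z : ℝ, 0 < z →
      MeijerGConverges 2 1 ![1] ![1, 1, 0] ((S.d_r ^ S.α_r / S.Xi * z : ℝ) : ℂ)) ∧
    IntegrableOn (S.rateIntegrand 1) (Set.Ioi (0 : ℝ)) ∧
    S.rateIntegral 1 = S.rayleighClosedForm := by
  have hlaw := hasLaw_gainLaw hd hu hindep
  have hint : Integrable (fun p : ℝ × ℝ => S.reir p.1 p.2)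
      (P.map fun ω => (‖h_d ω‖ ^ 2, ‖h_u ω‖ ^ 2)) := by
    rw [hlaw.map_eq]
    exact S.integrable_reir_gainLaw
  refine ⟨hint.comp_aemeasurable hlaw.aemeasurable, ⟨_, hasMeijerG_meanLogGain S.threshold_pos⟩,
    ?_, fun z hz => ⟨_, hasMeijerG_gainProductCDF (mul_pos S.threshold_pos hz)⟩,
    S.integrableOn_rateIntegrand_one, S.rateIntegral_one⟩
  have h := hlaw.integral_comp S.integrable_reir_gainLaw.aestronglyMeasurable
  rw [RadarLink.ergodicREIR, S.rayleighClosedForm_eq, meanLogGain]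
  rw [Function.comp_def] at h
  -- The cast and the constant are moved so that both sides are complex integrals over `gainLaw`,
  -- compared pointwise.
  rw [h, ← integral_const_mul, ← integral_complex_ofReal]
  congr 1 with p
  rw [S.reir_eq]
  push_cast
  rfl
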